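/- For a complex square matrix $M\in\mathbb{C}^{n\times n}$ let $\mathrm{ind}(M)$ be the smallest non-negative integer $k$ with $\mathrm{rank}(M^k)=\mathrm{rank}(M^{k+1})$, and let $M^{\text{core-EP}}$ be the core-EP inverse of $M$, that is, the unique matrix $X$ with $$XM^{k+1}=M^k,\qquad MX^2=X,\qquad (MX)^*=MX,\qquad k=\mathrm{ind}(M).$$ Call $M$ semistable if $\mathrm{ind}(M)\le 1$ and every nonzero eigenvalue $\lambda$ of $M$ satisfies $\mathrm{Re}\,\lambda<0$. Let $\|\cdot\|$ be the spectral norm. **Theorem.** Let $A\in\mathbb{C}^{n\times n}$ be semistable. Then there is $\delta(A)>0$, depending only on $A$, such that for every $E\in\mathbb{C}^{n\times n}$ with $$E=EAA^{\text{core-EP}}=A^{\text{core-EP}}AE\qquad\text{and}\qquad \|E\|<\delta(A),$$ the matrix function $t\mapsto \exp(t(A+E))\,AA^{\text{core-EP}}$ is integrable on $(0,\infty)$ and $$(A+E)^{\text{core-EP}}=-\int_0^\infty \exp(t(A+E))\,AA^{\text{core-EP}}\,dt.$$ -/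

import Mathlib

open scoped Matrix Matrix.Norms.L2Operator

namespace CoreEP

variable {n : ℕ}

/-- The index of `A`: the smallest non-negative integer `k` with
`rank (A ^ k) = rank (A ^ (k + 1))` (see `rank_pow_ind`). -/
noncomputable def ind (A : Matrix (Fin n) (Fin n) ℂ) : ℕ :=
  sInf {k : ℕ | (A ^ k).rank = (A ^ (k + 1)).rank}

/-- `X` solves the three equations that characterize the core-EP inverse of `A`. -/
structure IsCoreEPInverse (A X : Matrix (Fin n) (Fin n) ℂ) : Prop where
  mul_pow : X * A ^ (ind A + 1) = A ^ ind A
  mul_sq : A * X ^ 2 = X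
  conjTranspose_eq : (A * X)ᴴ = A * X

/-- The set of which the index is the infimum is not empty, so the index is its minimum. -/
theorem rank_pow_ind (A : Matrix (Fin n) (Fin n) ℂ) :
    (A ^ ind A).rank = (A ^ (ind A + 1)).rank := by
  have hne : {k : ℕ | (A ^ k).rank = (A ^ (k + 1)).rank}.Nonempty := by
    by_contra h
    rw [Set.not_nonempty_iff_eq_empty] at h
    have hlt : ∀ k, (A ^ (k + 1)).rank < (A ^ k).rank := by
      intro k
      refine lt_of_le_of_ne ?_ fun e => ?_
      · rw [pow_succ]; exact Matrix.rank_mul_le_left _ _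
      · have : k ∈ {k : ℕ | (A ^ k).rank = (A ^ (k + 1)).rank} := e.symm
        rw [h] at this
        exact this
    have key : ∀ k, (A ^ k).rank + k ≤ (A ^ 0).rank := by
      intro k
      induction k with
      | zero => simp
      | succ k ih => have := hlt k; omega
    have := key ((A ^ 0).rank + 1)
    omega
  exact Nat.sInf_mem hne

theorem exists_eq_mul_mul (M N : Matrix (Fin n) (Fin n) ℂ) (h : (M * N).rank = M.rank) :
    ∃ W, M = M * N * W := by
  have hle : LinearMap.range (M * N).mulVecLin ≤ LinearMap.range M.mulVecLin := by
    rw [Matrix.mulVecLin_mul]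
    exact LinearMap.range_comp_le_range _ _
  have heq := Submodule.eq_of_le_of_finrank_eq hle h
  have hc : ∀ j, ∃ w : Fin n → ℂ, (M * N) *ᵥ w = M.col j := by
    intro j
    have : M.col j ∈ LinearMap.range (M * N).mulVecLin := by
      rw [heq]
      exact ⟨Pi.single j 1, by simp⟩
    obtain ⟨w, hw⟩ := this
    exact ⟨w, by simpa using hw⟩
  choose w hw using hc
  refine ⟨Matrix.of fun i j => w j i, ?_⟩
  ext i j
  have := congrFun (hw j) i
  simp only [Matrix.col_apply] at this
  rw [← this]
  rfl

open scoped ComplexOrder in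
theorem existsUnique_isCoreEPInverse (A : Matrix (Fin n) (Fin n) ℂ) :
    ∃! X, IsCoreEPInverse A X := by
  set k := ind A with hk
  have hr : (A ^ k).rank = (A ^ (k + 1)).rank := rank_pow_ind A
  obtain ⟨C, hC⟩ := exists_eq_mul_mul (A ^ k) A (by rw [← pow_succ, ← hr])
  obtain ⟨D', hD'⟩ := exists_eq_mul_mul ((A ^ k)ᴴ) Aᴴ (by
    rw [← Matrix.conjTranspose_mul, ← pow_succ', Matrix.rank_conjTranspose,
      Matrix.rank_conjTranspose, ← hr])
  obtain ⟨W, hW⟩ := exists_eq_mul_mul ((A ^ k)ᴴ) (A ^ k) (by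
    rw [Matrix.rank_conjTranspose_mul_self, Matrix.rank_conjTranspose])
  have hD : A ^ k = D'ᴴ * A ^ (k + 1) := by
    have := congrArg Matrix.conjTranspose hD'
    simpa [Matrix.conjTranspose_mul, pow_succ'] using this
  have hWB : Wᴴ * ((A ^ k)ᴴ * A ^ k) = A ^ k := by
    have := congrArg Matrix.conjTranspose hW
    rw [Matrix.conjTranspose_mul, Matrix.conjTranspose_mul,
      Matrix.conjTranspose_conjTranspose] at this
    exact this.symm
  rw [← pow_succ] at hC
  have hPs : (A ^ k * W)ᴴ = A ^ k * W := by
    rw [Matrix.conjTranspose_mul]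
    conv_lhs => rw [hW]
    rw [← mul_assoc, hWB]
  have hPB : A ^ k * W * A ^ k = A ^ k := by
    rw [← hPs, Matrix.conjTranspose_mul, mul_assoc, hWB]
  have hAX : A * (A ^ k * (C * W)) = A ^ k * W := by
    rw [← mul_assoc, ← pow_succ', ← mul_assoc, ← hC]
  refine existsUnique_of_exists_of_unique ⟨A ^ k * (C * W), ?_, ?_, ?_⟩ ?_
  · rw [← hk]
    conv_lhs => rw [hD]
    rw [pow_succ' A k, mul_assoc D'ᴴ, mul_assoc A, hAX, mul_assoc D'ᴴ, ← pow_succ', pow_succ,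
      ← mul_assoc (A ^ k * W), hPB, ← pow_succ, ← hD]
  · rw [pow_two, ← mul_assoc, hAX, ← mul_assoc, hPB]
  · rw [hAX, hPs]
  · intro X Y hX hY
    have pw : ∀ Z, IsCoreEPInverse A Z → ∀ m, Z = A ^ m * Z ^ (m + 1) := by
      intro Z hZ m
      induction m with
      | zero => simp
      | succ m ih =>
        conv_lhs => rw [ih]
        rw [pow_succ A m, mul_assoc, pow_succ' Z m, ← hZ.mul_sq]
        rw [hZ.mul_sq, pow_succ' Z (m + 1), pow_succ' Z m, ← mul_assoc Z Z, ← pow_two,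
          ← mul_assoc A, hZ.mul_sq]
    have cross : ∀ Z V, IsCoreEPInverse A Z → IsCoreEPInverse A V →
        Z * (A * V) = V := by
      intro Z V hZ hV
      conv_lhs => rw [pw V hV k]
      rw [← mul_assoc A, ← pow_succ', ← mul_assoc, hZ.mul_pow, ← hk]
      exact (pw V hV k).symm
    have h1 : A * X = A * Y := by
      have e1 : A * X * (A * Y) = A * Y := by rw [mul_assoc, cross X Y hX hY]
      have e2 : A * Y * (A * X) = A * X := by rw [mul_assoc, cross Y X hY hX]
      have e3 := congrArg Matrix.conjTranspose e2
      rw [Matrix.conjTranspose_mul, hX.conjTranspose_eq, hY.conjTranspose_eq, e1] at e3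
      exact e3.symm
    calc X = X * (A * X) := (cross X X hX hX).symm
      _ = X * (A * Y) := by rw [h1]
      _ = Y := cross X Y hX hY

/-- The core-EP inverse of `A`: the unique solution of the system `IsCoreEPInverse A`. -/
noncomputable def coreEP (A : Matrix (Fin n) (Fin n) ℂ) : Matrix (Fin n) (Fin n) ℂ :=
  (existsUnique_isCoreEPInverse A).choose

theorem isCoreEPInverse_iff (A X : Matrix (Fin n) (Fin n) ℂ) :
    IsCoreEPInverse A X ↔ X = coreEP A :=
  ⟨fun h => (existsUnique_isCoreEPInverse A).unique h
      (existsUnique_isCoreEPInverse A).choose_spec.1,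
    fun h => h ▸ (existsUnique_isCoreEPInverse A).choose_spec.1⟩

/-- `A` is semistable: its index is at most `1` and its nonzero eigenvalues have negative
real part. -/
def IsSemistable (A : Matrix (Fin n) (Fin n) ℂ) : Prop :=
  ind A ≤ 1 ∧ ∀ z : ℂ, Module.End.HasEigenvalue (Matrix.toLin' A) z → z ≠ 0 → z.re < 0

end CoreEP

namespace CoreEP

open MeasureTheory Filter Topology Asymptotics

/-! ### Exponential decay and its integral in a Banach algebra -/

section BanachAlgebra

variable {𝔸 : Type*} [NormedRing 𝔸] [NormedAlgebra ℂ 𝔸] [CompleteSpace 𝔸]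

/-! Put `P = A * coreEP A`. Index at most one makes `P` an idempotent with `P * A = A`, and `A` is
invertible on the range of `P`. The matrix `C = A * P - (1 - P) + E` acts as `A + E` on that range,
while the added `-(1 - P)` moves the zero eigenvalue of `A` to `-1`. For `E = 0` all its eigenvalues
lie in the open left half-plane, so some `exp (m • C)` is a contraction, and for that fixed `m` this
survives small `E`. Hence the integral of `exp (t • C)` is `-C⁻¹`. Since `P` intertwines `C` and `A
+ E`, the integral in the theorem is `-P * C⁻¹`, and `P * C⁻¹` satisfies the core equations for `A +
E`. -/

theorem continuous_exp_smul (a : 𝔸) : Continuous fun t : ℝ => NormedSpace.exp (t • a) := by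
  let _ : NormedAlgebra ℚ 𝔸 := NormedAlgebra.restrictScalars ℚ ℂ 𝔸
  exact NormedSpace.exp_continuous.comp (by fun_prop)

theorem exp_nat_mul_add_smul (a : 𝔸) (m k : ℕ) (s : ℝ) :
    NormedSpace.exp (((k * m + s : ℝ)) • a) =
      NormedSpace.exp (m • a) ^ k * NormedSpace.exp (s • a) := by
  let _ : NormedAlgebra ℚ 𝔸 := NormedAlgebra.restrictScalars ℚ ℂ 𝔸
  rw [← NormedSpace.exp_nsmul, ← NormedSpace.exp_add_of_commute]
  · congr 1
    rw [add_smul, smul_smul, ← Nat.cast_mul, Nat.cast_smul_eq_nsmul]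
  · exact (((Commute.refl a).smul_right s).smul_left m).smul_left k

/-- If some `exp (m • a)` is a strict contraction, then `exp (t • a)` decays exponentially. -/
theorem exists_isBigO_exp_smul (a : 𝔸) (m : ℕ) (hm : 0 < m)
    (h : ‖NormedSpace.exp (m • a)‖ < 1) :
    ∃ b : ℝ, 0 < b ∧
      (fun t : ℝ => NormedSpace.exp (t • a)) =O[atTop] fun t => Real.exp (-b * t) := by
  obtain ⟨r, hr1, hr⟩ := exists_between (max_lt h one_pos)
  obtain ⟨hqr, hr0⟩ := max_lt_iff.1 hr1
  have hm' : (0 : ℝ) < m := by exact_mod_cast hm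
  set c : ℝ := -Real.log r with hc
  have hc0 : 0 < c := neg_pos.2 (Real.log_neg hr0 hr)
  have hrc : ∀ k : ℕ, r ^ k = Real.exp (-c * k) := by
    intro k
    rw [hc, neg_neg, mul_comm, Real.exp_nat_mul, Real.exp_log hr0]
  obtain ⟨K, hK⟩ := (isCompact_Icc (a := (0 : ℝ)) (b := m)).exists_bound_of_continuousOn
    (continuous_exp_smul a).continuousOn
  have hK0 : 0 ≤ K := (norm_nonneg _).trans (hK 0 ⟨le_rfl, hm'.le⟩)
  -- The norm of `1` is not assumed to be `1`; `L` covers the power `k = 0`.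
  set L : ℝ := ‖(1 : 𝔸)‖ + 1 with hL
  have hpow : ∀ k : ℕ, ‖NormedSpace.exp (m • a) ^ k‖ ≤ L * r ^ k := by
    intro k
    rcases Nat.eq_zero_or_pos k with rfl | hk
    · simp [hL]
    · calc ‖NormedSpace.exp (m • a) ^ k‖ ≤ ‖NormedSpace.exp (m • a)‖ ^ k := norm_pow_le' _ hk
        _ ≤ r ^ k := pow_le_pow_left₀ (norm_nonneg _) hqr.le k
        _ ≤ L * r ^ k := le_mul_of_one_le_left (pow_nonneg hr0.le k) (by simp [hL])
  -- The factor `exp c` pays for rounding `t / m` down to an integer; `K` bounds the remainder on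
  -- `[0, m]`.
  refine ⟨c / m, div_pos hc0 hm', IsBigO.of_bound (L * Real.exp c * K) ?_⟩
  filter_upwards [eventually_ge_atTop 0] with t ht
  set k : ℕ := ⌊t / m⌋₊ with hk
  have hk1 : (k : ℝ) * m ≤ t := by
    rw [← le_div_iff₀ hm']; exact Nat.floor_le (by positivity)
  have hk2 : t / m < k + 1 := Nat.lt_floor_add_one _
  have hk3 : t < (k + 1) * m := (div_lt_iff₀ hm').1 hk2
  have ht' : t = k * m + (t - k * m) := by ring
  have hL0 : 0 ≤ L := by positivity
  rw [Real.norm_of_nonneg (Real.exp_pos _).le]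
  calc ‖NormedSpace.exp (t • a)‖
      = ‖NormedSpace.exp (m • a) ^ k * NormedSpace.exp ((t - k * m) • a)‖ := by
        rw [← exp_nat_mul_add_smul, ← ht']
    _ ≤ (L * r ^ k) * K := (norm_mul_le _ _).trans <|
        mul_le_mul (hpow k) (hK _ ⟨by linarith, by linarith⟩) (norm_nonneg _) (by positivity)
    _ ≤ (L * (Real.exp c * Real.exp (-(c / m) * t))) * K := by
        rw [hrc, ← Real.exp_add]
        have : -c * k ≤ c + -(c / m) * t := by
          have e : c / m * t = c * (t / m) := by ring
          nlinarith
        gcongr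
    _ = L * Real.exp c * K * Real.exp (-(c / m) * t) := by ring

theorem integrableOn_exp_smul (a : 𝔸) (m : ℕ) (hm : 0 < m)
    (h : ‖NormedSpace.exp (m • a)‖ < 1) :
    IntegrableOn (fun t : ℝ => NormedSpace.exp (t • a)) (Set.Ioi 0) := by
  obtain ⟨b, hb, hO⟩ := exists_isBigO_exp_smul a m hm h
  have hc := continuous_exp_smul a
  have := integrable_of_isBigO_exp_neg (a := 0) hb hc.norm.continuousOn hO.norm_left
  exact (integrable_norm_iff hc.aestronglyMeasurable.restrict).1 this

/-- The integrand `a * exp (t • a)` is the derivative of `exp (t • a)`, which runs from `1` to `0`.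
-/
theorem mul_integral_exp_smul (a : 𝔸) (m : ℕ) (hm : 0 < m)
    (h : ‖NormedSpace.exp (m • a)‖ < 1) :
    a * ∫ t in Set.Ioi (0 : ℝ), NormedSpace.exp (t • a) = -1 := by
  obtain ⟨b, hb, hO⟩ := exists_isBigO_exp_smul a m hm h
  have hint := integrableOn_exp_smul a m hm h
  have hlim : Tendsto (fun t : ℝ => NormedSpace.exp (t • a)) atTop (𝓝 0) :=
    hO.trans_tendsto <| Real.tendsto_exp_atBot.comp <|
      (tendsto_const_mul_atBot_of_neg (neg_neg_of_pos hb)).2 tendsto_id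
  have hcm : ∫ t in Set.Ioi (0 : ℝ), a * NormedSpace.exp (t • a) =
      a * ∫ t in Set.Ioi (0 : ℝ), NormedSpace.exp (t • a) :=
    integral_const_mul_of_integrable hint
  rw [← hcm, integral_Ioi_of_hasDerivAt_of_tendsto' (m := 0)
    (fun t _ => hasDerivAt_exp_smul_const' a t) (hint.const_mul' a) hlim]
  simp

/-- Gelfand's formula: powers of an element of spectral radius below one become contractions. -/
theorem exists_norm_pow_lt_one (a : 𝔸) (h : ∀ z ∈ spectrum ℂ a, ‖z‖ < 1) :
    ∃ m : ℕ, 0 < m ∧ ‖a ^ m‖ < 1 := by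
  cases subsingleton_or_nontrivial 𝔸
  · exact ⟨1, one_pos, by simp [Subsingleton.elim a 0]⟩
  have hr : spectralRadius ℂ a < (1 : NNReal) :=
    spectrum.spectralRadius_lt_of_forall_lt a fun z hz => h z hz
  have ht := spectrum.pow_nnnorm_pow_one_div_tendsto_nhds_spectralRadius a
  obtain ⟨m, hm, hm0⟩ := ((ht.eventually_lt_const hr).and (eventually_gt_atTop 0)).exists
  refine ⟨m, hm0, ?_⟩
  by_contra! hge
  refine absurd hm (not_lt.2 ?_)
  have : (1 : ENNReal) ≤ ‖a ^ m‖₊ := by exact_mod_cast hge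
  simpa using ENNReal.one_le_rpow this (by positivity)

theorem exists_norm_exp_lt_one_of_near (a : 𝔸) (m : ℕ) (h : ‖NormedSpace.exp (m • a)‖ < 1) :
    ∃ δ : ℝ, 0 < δ ∧ ∀ e : 𝔸, ‖e‖ < δ → ‖NormedSpace.exp (m • (a + e))‖ < 1 := by
  let _ : NormedAlgebra ℚ 𝔸 := NormedAlgebra.restrictScalars ℚ ℂ 𝔸
  have hc : Continuous fun e : 𝔸 => ‖NormedSpace.exp (m • (a + e))‖ :=
    (NormedSpace.exp_continuous.comp (by fun_prop)).norm
  have h0 : ∀ᶠ e in 𝓝 (0 : 𝔸), ‖NormedSpace.exp (m • (a + e))‖ < 1 :=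
    hc.continuousAt.eventually_lt_const (by simpa using h)
  obtain ⟨δ, hδ, hb⟩ := Metric.eventually_nhds_iff.1 h0
  exact ⟨δ, hδ, fun e he => hb (by simpa using he)⟩

end BanachAlgebra

variable {n : ℕ}

/-! ### Eigenvalues of the matrix exponential -/

theorem exp_mulVec_of_eigenvector (C : Matrix (Fin n) (Fin n) ℂ) (z : ℂ) (w : Fin n → ℂ)
    (h : C *ᵥ w = z • w) : NormedSpace.exp C *ᵥ w = Complex.exp z • w := by
  let _ : NormedAlgebra ℚ (Matrix (Fin n) (Fin n) ℂ) := NormedAlgebra.restrictScalars ℚ ℂ _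
  -- A rank-one matrix with every column `w` turns the eigenvector equation into an intertwining
  -- relation, which `exp` preserves.
  have hs : SemiconjBy (Matrix.vecMulVec w 1) (algebraMap ℂ (Matrix (Fin n) (Fin n) ℂ) z) C := by
    rw [SemiconjBy, Matrix.mul_vecMulVec, h, ← Algebra.commutes, ← Algebra.smul_def,
      Matrix.smul_vecMulVec]
  have he := hs.exp_right
  rw [← NormedSpace.algebraMap_exp_comm, SemiconjBy, Matrix.mul_vecMulVec, ← Algebra.commutes,
    ← Algebra.smul_def, ← Matrix.smul_vecMulVec, ← Complex.exp_eq_exp_ℂ] at he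
  ext i
  have := congrFun (congrFun he i) i
  simpa [Matrix.vecMulVec_apply] using this.symm

/-- An eigenspace of `exp C` is invariant under `C`, which commutes with `exp C`, so it contains an
eigenvector of `C`. -/
theorem exists_eigenvector_of_mem_spectrum_exp (C : Matrix (Fin n) (Fin n) ℂ) (z : ℂ)
    (hz : z ∈ spectrum ℂ (NormedSpace.exp C)) :
    ∃ (l : ℂ) (w : Fin n → ℂ), w ≠ 0 ∧ C *ᵥ w = l • w ∧ Complex.exp l = z := by
  rw [← Matrix.spectrum_toLin', ← Module.End.hasEigenvalue_iff_mem_spectrum] at hz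
  set V := Module.End.eigenspace (Matrix.toLin' (NormedSpace.exp C)) z with hV
  have hcomm : Commute (Matrix.toLin' (NormedSpace.exp C)) (Matrix.toLin' C) := by
    have : Commute (NormedSpace.exp C) C := (Commute.refl C).exp_left
    exact this.map Matrix.toLinAlgEquiv'
  have hmaps : Set.MapsTo (Matrix.toLin' C) V V :=
    Module.End.mapsTo_genEigenspace_of_comm hcomm z 1
  have : Nontrivial V := Submodule.nontrivial_iff_ne_bot.2 hz
  obtain ⟨l, hl⟩ := Module.End.exists_eigenvalue ((Matrix.toLin' C).restrict hmaps)
  obtain ⟨w, hw⟩ := hl.exists_hasEigenvector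
  have hw0 : (w : Fin n → ℂ) ≠ 0 := by simpa using hw.2
  have hCw : C *ᵥ (w : Fin n → ℂ) = l • (w : Fin n → ℂ) := by
    exact congrArg Subtype.val hw.apply_eq_smul
  refine ⟨l, w, hw0, hCw, ?_⟩
  have h1 : NormedSpace.exp C *ᵥ (w : Fin n → ℂ) = z • (w : Fin n → ℂ) := by
    simpa using Module.End.mem_eigenspace_iff.1 w.2
  rw [exp_mulVec_of_eigenvector C l w hCw] at h1
  exact smul_left_injective ℂ hw0 h1

/-- Lyapunov: if all eigenvalues of `C` lie in the open left half-plane, then `exp (m • C)` is a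
strict contraction for some `m > 0`. -/
theorem exists_norm_exp_nsmul_lt_one (C : Matrix (Fin n) (Fin n) ℂ)
    (h : ∀ (l : ℂ) (w : Fin n → ℂ), w ≠ 0 → C *ᵥ w = l • w → l.re < 0) :
    ∃ m : ℕ, 0 < m ∧ ‖NormedSpace.exp (m • C)‖ < 1 := by
  obtain ⟨m, hm, hlt⟩ := exists_norm_pow_lt_one (NormedSpace.exp C) fun z hz => by
    obtain ⟨l, w, hw, hCw, rfl⟩ := exists_eigenvector_of_mem_spectrum_exp C z hz
    rw [Complex.norm_exp]
    exact Real.exp_lt_one_iff.mpr (h l w hw hCw)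
  exact ⟨m, hm, by rwa [Matrix.exp_nsmul]⟩

/-! ### The core equations and the perturbation theorem -/

/-- For a matrix of index at most one, the defining equation of the core-EP inverse reads
`X * A ^ 2 = A`. -/
theorem coreEP_mul_mul_self {A : Matrix (Fin n) (Fin n) ℂ} (hA : ind A ≤ 1) :
    coreEP A * A * A = A := by
  have h := ((isCoreEPInverse_iff A _).2 rfl).mul_pow
  interval_cases hk : ind A
  · simp only [zero_add, pow_one, pow_zero] at h
    rw [h, one_mul]
  · simpa [pow_succ, mul_assoc] using h

theorem isUnit_of_ind_eq_zero {B : Matrix (Fin n) (Fin n) ℂ} (h : ind B = 0) : IsUnit B := by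
  have := rank_pow_ind B
  rw [h] at this
  obtain ⟨W, hW⟩ := exists_eq_mul_mul 1 B (by simpa using this.symm)
  exact IsUnit.of_mul_eq_one W (by simpa using hW.symm)

/-- The core (group-type) equations suffice to identify the core-EP inverse. -/
theorem eq_coreEP_of_mul_mul_self {B X : Matrix (Fin n) (Fin n) ℂ} (h1 : X * B * B = B)
    (h2 : B * X ^ 2 = X) (h3 : (B * X)ᴴ = B * X) : X = coreEP B := by
  refine (isCoreEPInverse_iff B X).1 ⟨?_, h2, h3⟩
  rcases hk : ind B with _ | k
  · have hu := isUnit_of_ind_eq_zero hk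
    simpa using hu.mul_right_cancel (h1.trans (one_mul B).symm)
  · rw [pow_succ' B (k + 1), pow_succ' B k, ← mul_assoc, ← mul_assoc, h1]

end CoreEP

open CoreEP in
theorem theorem5p2 (n : ℕ) (A : Matrix (Fin n) (Fin n) ℂ) (hA : CoreEP.IsSemistable A) :
    ∃ δ : ℝ, 0 < δ ∧ ∀ E : Matrix (Fin n) (Fin n) ℂ,
      E = E * A * CoreEP.coreEP A → E = CoreEP.coreEP A * A * E → ‖E‖ < δ →
        MeasureTheory.IntegrableOn
          (fun t : ℝ => NormedSpace.exp (t • (A + E)) * (A * CoreEP.coreEP A)) (Set.Ioi 0) ∧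
        CoreEP.coreEP (A + E) =
          -∫ t in Set.Ioi (0 : ℝ), NormedSpace.exp (t • (A + E)) * (A * CoreEP.coreEP A) := by
  obtain ⟨hi, hev⟩ := hA
  have hX := (isCoreEPInverse_iff A _).2 rfl
  have hXAA := coreEP_mul_mul_self hi
  set X := coreEP A
  have hAXX : A * X * X = X := by rw [mul_assoc, ← pow_two, hX.mul_sq]
  obtain ⟨P, hP⟩ : ∃ P, P = A * X := ⟨_, rfl⟩
  have hXAX : X * P = X := by
    calc X * P = X * A * X := by rw [hP, mul_assoc]
      _ = X * A * (A * X * X) := by rw [hAXX]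
      _ = X * A * A * X * X := by simp only [mul_assoc]
      _ = X := by rw [hXAA, hAXX]
  have hPP : P * P = P := by
    nth_rw 1 [hP]
    rw [mul_assoc, hXAX, hP]
  have hPA : P * A = A := by
    calc P * A = A * X * (X * A * A) := by rw [hXAA, hP]
      _ = A * X * X * A * A := by simp only [mul_assoc]
      _ = A := by rw [hAXX, hXAA]
  have hXAP : X * (A * P) = P := by
    rw [hP, ← mul_assoc, ← mul_assoc, hXAA]
  have hPXA : P * (X * A) = X * A := by rw [hP, ← mul_assoc, hAXX]
  have hstable : ∀ (l : ℂ) (w : Fin n → ℂ), w ≠ 0 →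
      (A * P - (1 - P)) *ᵥ w = l • w → l.re < 0 := by
    intro l w hw h
    have hCP : P * (A * P - (1 - P)) = A * P := by
      rw [mul_sub, mul_sub, mul_one, hPP, sub_self, sub_zero, ← mul_assoc, hPA]
    have hP1 : A *ᵥ (P *ᵥ w) = l • (P *ᵥ w) := by
      rw [Matrix.mulVec_mulVec, ← hCP, ← Matrix.mulVec_mulVec, h, Matrix.mulVec_smul]
    -- If `P` kills `w` then `l = -1`; otherwise `P *ᵥ w` is an eigenvector of `A`, and `l ≠ 0`
    -- because `X` inverts `A` on the range of `P`.
    by_cases h0 : P *ᵥ w = 0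
    · have : (-1 : ℂ) • w = l • w := by
        rw [← h, Matrix.sub_mulVec, Matrix.sub_mulVec, ← Matrix.mulVec_mulVec, h0]
        simp
      rw [← smul_left_injective ℂ hw this]
      simp
    · refine hev l (Module.End.hasEigenvalue_of_hasEigenvector (x := P *ᵥ w)
        ⟨Module.End.mem_eigenspace_iff.2 (by simpa using hP1), h0⟩) ?_
      rintro rfl
      apply h0
      rw [← hXAP, ← Matrix.mulVec_mulVec, ← Matrix.mulVec_mulVec, hP1]
      simp
  obtain ⟨m, hm, hlt⟩ := exists_norm_exp_nsmul_lt_one _ hstable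
  obtain ⟨δ, hδ, hnear⟩ := exists_norm_exp_lt_one_of_near _ m hlt
  refine ⟨δ, hδ, fun E hE1 hE2 hE => ?_⟩
  have hEP : E * P = E := by rw [hP, ← mul_assoc, ← hE1]
  have hPE : P * E = E := by rw [hE2, ← mul_assoc, hPXA]
  obtain ⟨C, hC⟩ : ∃ C, C = A * P - (1 - P) + E := ⟨_, rfl⟩
  obtain ⟨B, hB⟩ : ∃ B, B = A + E := ⟨_, rfl⟩
  have hPB : P * B = B := by rw [hB, mul_add, hPA, hPE]
  have hCP : C * P = B * P := by
    rw [hC, hB, add_mul, add_mul, sub_mul, sub_mul, one_mul, hPP, mul_assoc, hPP]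
    simp
  have hPC : P * C = B * P := by
    rw [hC, hB, mul_add, mul_sub, mul_sub, mul_one, hPP, ← mul_assoc, hPA, hPE, add_mul, hEP]
    simp
  have hlt' := hnear E hE
  rw [← hC] at hlt'
  have hint := integrableOn_exp_smul C m hm hlt'
  have hJ := mul_integral_exp_smul C m hm hlt'
  obtain ⟨J, hJdef⟩ : ∃ J, J = ∫ t in Set.Ioi (0 : ℝ), NormedSpace.exp (t • C) := ⟨_, rfl⟩
  rw [← hJdef] at hJ
  have hfun : (fun t : ℝ => NormedSpace.exp (t • B) * P) =
      fun t : ℝ => P * NormedSpace.exp (t • C) := by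
    funext t
    let _ : NormedAlgebra ℚ (Matrix (Fin n) (Fin n) ℂ) := NormedAlgebra.restrictScalars ℚ ℂ _
    have hs : SemiconjBy P (t • C) (t • B) := by
      rw [SemiconjBy, mul_smul_comm, hPC, smul_mul_assoc]
    exact hs.exp_right.eq.symm
  rw [← hP, ← hB, hfun]
  have hcm : ∫ t in Set.Ioi (0 : ℝ), P * NormedSpace.exp (t • C) = P * J := by
    rw [hJdef]; exact integral_const_mul_of_integrable hint
  rw [hcm]
  refine ⟨hint.const_mul' P, ?_⟩
  have hCD : C * -J = 1 := by rw [mul_neg, hJ, neg_neg]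
  have hDC : -J * C = 1 := mul_eq_one_comm.1 hCD
  rw [← mul_neg]
  generalize -J = D at hCD hDC
  -- `D` is the inverse of `C`, and `C` commutes with `P`.
  have hDP : D * P = P * D := by
    calc D * P = D * (P * C) * D := by rw [mul_assoc, mul_assoc, hCD, mul_one]
      _ = P * D := by rw [hPC, ← hCP, ← mul_assoc, hDC, one_mul]
  have hBX : B * (P * D) = P := by
    rw [← mul_assoc, ← hPC, mul_assoc, hCD, mul_one]
  symm
  apply eq_coreEP_of_mul_mul_self
  · calc P * D * B * B = D * P * B * B := by rw [hDP]
      _ = D * (P * B) * B := by simp only [mul_assoc]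
      _ = D * (B * P) * B := by rw [hPB, mul_assoc, mul_assoc, mul_assoc, hPB]
      _ = B := by rw [← hCP, ← mul_assoc D, hDC, one_mul, hPB]
  · rw [pow_two, ← mul_assoc, hBX, ← mul_assoc, hPP]
  · rw [hBX, hP, hX.conjTranspose_eq]
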